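/- A partition with designated summands of $n$ is a partition of $n$ in which, for each part size that occurs, exactly one of the occurrences of that part is designated. Let $PD_2(n)$ denote the number of partitions of $n$ with designated summands that are $2$-regular, i.e. in which no part is divisible by $2$. For $r\ge 1$ let $f_r=\prod_{j\ge 1}(1-q^{rj})\in\mathbb{Z}[[q]]$. Theorem. For all $n\ge 0$, $$PD_2(48n+26)\equiv 0 \pmod 4 .$$ Moreover, as power series (coefficient by coefficient), $$\sum_{n\ge 0} PD_2(16n+10)\,q^n \equiv 2 f_3 f_6^2 \pmod 4,$$ and $2f_3f_6^2$ is a power series in $q^3$, i.e. the coefficient of $q^n$ in it is $0$ whenever $3\nmid n$. -/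

import Mathlib

open PowerSeries
open scoped PowerSeries.WithPiTopology

/-- A partition of `n` with designated summands: an ordinary partition of `n` in which, for every
part size `i` that occurs, exactly one of the occurrences of `i` is designated. -/
structure DesignatedPartition (n : ℕ) where
  /-- the underlying partition -/
  partition : n.Partition
  /-- for each part size that occurs, the position of the designated one among its occurrences -/
  designated : (i : partition.parts.toFinset) → Fin (partition.parts.count i.1)

/-- A partition with designated summands is `k`-regular if no part is divisible by `k`. -/
def DesignatedPartition.IsRegular {n : ℕ} (k : ℕ) (d : DesignatedPartition n) : Prop :=
  ∀ i ∈ d.partition.parts, ¬ k ∣ i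

/-- Partitions with designated summands, as a sigma type. -/
def DesignatedPartition.equivSigma (n : ℕ) :
    DesignatedPartition n ≃
      (p : n.Partition) × ((i : p.parts.toFinset) → Fin (p.parts.count i.1)) where
  toFun d := ⟨d.partition, d.designated⟩
  invFun s := ⟨s.1, s.2⟩
  left_inv _ := rfl
  right_inv _ := rfl

instance (n : ℕ) : Finite (DesignatedPartition n) :=
  Finite.of_equiv _ (DesignatedPartition.equivSigma n).symm

/-- `PD k n` is the number of `k`-regular partitions of `n` with designated summands
(a finite number, as the type of all partitions of `n` with designated summands is finite). -/
noncomputable def PD (k n : ℕ) : ℕ :=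
  Nat.card {d : DesignatedPartition n // d.IsRegular k}

/-- `eulerF r = (1 - q ^ r) (1 - q ^ (2 r)) (1 - q ^ (3 r)) ⋯` as a formal power series in `q`
with integer coefficients (the infinite product converges for `r ≥ 1`, coefficient by
coefficient). -/
noncomputable def eulerF (r : ℕ) : ℤ⟦X⟧ :=
  ∏' j : ℕ, (1 - (X : ℤ⟦X⟧) ^ (r * (j + 1)))

/-- The product that defines `eulerF r` converges for `r ≥ 1`. -/
theorem multipliable_eulerF {r : ℕ} (hr : 0 < r) :
    Multipliable fun j : ℕ ↦ (1 - (X : ℤ⟦X⟧) ^ (r * (j + 1))) := by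
  simp_rw [sub_eq_add_neg]
  refine PowerSeries.WithPiTopology.multipliable_one_add_of_tendsto_order_atTop_nhds_top ℤ ?_
  refine ENat.tendsto_nhds_top_iff_natCast_lt.mpr fun n ↦ Filter.eventually_atTop.mpr ⟨n, ?_⟩
  intro m hm
  rw [order_neg, order_X_pow]
  norm_cast
  nlinarith

/-! Write f_r for `eulerF r`, ψ(q) = ∑ q^(k(k+1)/2) and φ(q) = ∑ q^(u²). An odd part size i
contributes 1 + ∑ c q^(ic) = (1-q^(6i)) / ((1-q^i)(1-q^(2i))(1-q^(3i))). With Gauss's ψ(q) =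
f_2²/f_1 this gives ∑ PD_2(n) q^n = f_4 ψ(q)ψ(q³) / (f_2² f_12).

The engine is the 2-dissection ψ(q)ψ(q³) = φ(q⁶)ψ(q⁴) + q φ(q²)ψ(q¹²) (`psi_mul_psi_three`). Its
even part gives ∑ PD_2(2n) q^n, which ψ(q³)² = φ(q³)ψ(q⁶) rewrites as f_4² (ψ(q)ψ(q³))² / (f_2⁴
f_12²). The odd part of a square (a + qb)², with a and b even, is 2qab, so ∑ PD_2(4n+2) q^n = 2D
with D integral.

It remains to find D modulo 2. There φ ≡ 1, f_{2r} ≡ f_r² and ψ(q^r) ≡ f_r³, so D ≡ P(q²) with P =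
f_1³ f_3. Dissecting ψ(q)ψ(q³) once more modulo 2 shows that the odd part of P yields f_3 f_6²,
hence the congruence for PD_2(16n+10). That series lives in q³, and 48n+26 = 16(3n+1)+10. -/

open Filter Finset

/-! ### Finite form of Gauss's triangular identity -/

section GaussTriangular

variable {R : Type*} [CommRing R]

theorem triangle_two_mul (n : ℕ) : 2 * n * (2 * n + 1) / 2 = n * (2 * n + 1) := by
  rw [mul_assoc, Nat.mul_div_cancel_left _ two_pos]

theorem triangle_two_mul_add_one (n : ℕ) :
    (2 * n + 1) * (2 * n + 1 + 1) / 2 = n * (2 * n + 1) + (2 * n + 1) := by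
  have : (2 * n + 1) * (2 * n + 1 + 1) = 2 * (n * (2 * n + 1) + (2 * n + 1)) := by ring
  rw [this, Nat.mul_div_cancel_left _ two_pos]

/-- A finite form of Gauss's identity for the theta series of the triangular numbers. -/
theorem prod_odd_mul_sum_triangle (q : R) (n : ℕ) :
    (∏ j ∈ range n, (1 - q ^ (2 * j + 1))) * ∑ k ∈ range (2 * n), q ^ (k * (k + 1) / 2) =
      ∑ s ∈ range n, (∏ k ∈ Ico s n, (1 - q ^ (2 * k + 2))) *
        (∏ j ∈ range s, (1 - q ^ (2 * j + 1))) * q ^ (s * (2 * n + 1)) := by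
  induction n with
  | zero => simp
  | succ n ih =>
    set o : ℕ → R := fun s ↦ ∏ j ∈ range s, (1 - q ^ (2 * j + 1)) with ho
    have ho' (s : ℕ) : ∏ j ∈ range s, (1 - q ^ (2 * j + 1)) = o s := rfl
    have hos (s : ℕ) : o (s + 1) = o s * (1 - q ^ (2 * s + 1)) := prod_range_succ _ _
    simp only [ho'] at ih ⊢
    -- A telescoping certificate: the summand for n+1 is 1 - q^(2n+1) times the summand for n, plus
    -- U(s+1) - U(s). The factor 1 - q^(2s) makes U(0) vanish.
    let U : ℕ → R := fun s ↦
      (1 - q ^ (2 * s)) * (∏ k ∈ Ico s n, (1 - q ^ (2 * k + 2))) * o s * q ^ (s * (2 * n + 1))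
    have hU : ∑ s ∈ range n, (U (s + 1) - U s) = U n - U 0 := sum_range_sub U n
    have hU0 : U 0 = 0 := by simp [U]
    have hUn : U n = (1 - q ^ (2 * n)) * o n * q ^ (n * (2 * n + 1)) := by simp [U]
    have hterm : ∀ s ∈ range n,
        (∏ k ∈ Ico s (n + 1), (1 - q ^ (2 * k + 2))) * o s * q ^ (s * (2 * (n + 1) + 1)) =
        (1 - q ^ (2 * n + 1)) *
          ((∏ k ∈ Ico s n, (1 - q ^ (2 * k + 2))) * o s * q ^ (s * (2 * n + 1))) +
        (U (s + 1) - U s) := by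
      intro s hs
      have hs := mem_range.mp hs
      have h1 : ∏ k ∈ Ico s (n + 1), (1 - q ^ (2 * k + 2)) =
          (∏ k ∈ Ico s n, (1 - q ^ (2 * k + 2))) * (1 - q ^ (2 * n + 2)) :=
        prod_Ico_succ_top hs.le _
      have h2 : ∏ k ∈ Ico s n, (1 - q ^ (2 * k + 2)) =
          (1 - q ^ (2 * s + 2)) * ∏ k ∈ Ico (s + 1) n, (1 - q ^ (2 * k + 2)) :=
        prod_eq_prod_Ico_succ_bot hs _
      have h3 : U (s + 1) = (∏ k ∈ Ico s n, (1 - q ^ (2 * k + 2))) *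
          (o s * (1 - q ^ (2 * s + 1))) * q ^ ((s + 1) * (2 * n + 1)) := by
        simp only [U, h2, hos]
        ring
      rw [h3, h1]
      simp only [U]
      ring
    rw [sum_range_succ, sum_congr rfl hterm, sum_add_distrib, ← mul_sum, ← ih, hU, hU0, hUn, hos,
      show 2 * (n + 1) = 2 * n + 1 + 1 by ring, sum_range_succ, sum_range_succ, triangle_two_mul,
      triangle_two_mul_add_one]
    simp only [Nat.Ico_succ_singleton, prod_singleton]
    ring

end GaussTriangular

/-! ### Coefficientwise limits and Euler products -/

/-- A sequence of integral power series converges if every coefficient is eventually constant. -/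
theorem PowerSeries.tendsto_of_eventually_coeff_eq {u : ℕ → ℤ⟦X⟧} {g : ℤ⟦X⟧}
    (h : ∀ d, ∀ᶠ n in atTop, coeff d (u n) = coeff d g) : Tendsto u atTop (nhds g) := by
  rw [PowerSeries.WithPiTopology.tendsto_iff_coeff_tendsto]
  exact fun d ↦ tendsto_nhds_of_eventually_eq (h d)

theorem PowerSeries.tendsto_iff_eventually_coeff_eq {u : ℕ → ℤ⟦X⟧} {g : ℤ⟦X⟧} :
    Tendsto u atTop (nhds g) ↔ ∀ d, ∀ᶠ n in atTop, coeff d (u n) = coeff d g := by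
  rw [PowerSeries.WithPiTopology.tendsto_iff_coeff_tendsto]
  simp [nhds_discrete]

theorem tendsto_eulerF {r : ℕ} (hr : 0 < r) :
    Tendsto (fun n ↦ ∏ j ∈ range n, (1 - (X : ℤ⟦X⟧) ^ (r * (j + 1)))) atTop (nhds (eulerF r)) :=
  (multipliable_eulerF hr).hasProd.tendsto_prod_nat

/-- `oddEulerF r = (1 - q ^ r) (1 - q ^ (3 r)) (1 - q ^ (5 r)) ⋯`. -/
noncomputable def oddEulerF (r : ℕ) : ℤ⟦X⟧ :=
  ∏' j : ℕ, (1 - (X : ℤ⟦X⟧) ^ (r * (2 * j + 1)))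

theorem tendsto_oddEulerF {r : ℕ} (hr : 0 < r) :
    Tendsto (fun n ↦ ∏ j ∈ range n, (1 - (X : ℤ⟦X⟧) ^ (r * (2 * j + 1)))) atTop
      (nhds (oddEulerF r)) := by
  refine Multipliable.hasProd (f := fun j : ℕ ↦ (1 - (X : ℤ⟦X⟧) ^ (r * (2 * j + 1)))) ?_
    |>.tendsto_prod_nat
  simp_rw [sub_eq_add_neg]
  refine PowerSeries.WithPiTopology.multipliable_one_add_of_tendsto_order_atTop_nhds_top ℤ ?_
  refine ENat.tendsto_nhds_top_iff_natCast_lt.mpr fun n ↦ Filter.eventually_atTop.mpr ⟨n, ?_⟩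
  intro m hm
  rw [order_neg, order_X_pow]
  norm_cast
  nlinarith

theorem tendsto_two_mul_atTop : Tendsto (fun n : ℕ ↦ 2 * n) atTop atTop :=
  tendsto_id.const_mul_atTop' two_pos

theorem prod_range_two_mul {M : Type*} [CommMonoid M] (a : ℕ → M) (n : ℕ) :
    ∏ j ∈ range (2 * n), a j = (∏ j ∈ range n, a (2 * j)) * ∏ j ∈ range n, a (2 * j + 1) := by
  induction n with
  | zero => simp
  | succ n ih =>
    rw [show 2 * (n + 1) = 2 * n + 1 + 1 by ring, prod_range_succ, prod_range_succ, ih,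
      prod_range_succ, prod_range_succ]
    simp only [mul_assoc, mul_left_comm, mul_comm]

theorem oddEulerF_mul_eulerF {r : ℕ} (hr : 0 < r) :
    oddEulerF r * eulerF (2 * r) = eulerF r := by
  refine tendsto_nhds_unique ((tendsto_oddEulerF hr).mul (tendsto_eulerF (by positivity)))
    (((tendsto_eulerF hr).comp tendsto_two_mul_atTop).congr fun n ↦ ?_)
  simp only [Function.comp, prod_range_two_mul]
  congr 1
  refine prod_congr rfl fun j _ ↦ ?_
  ring_nf

theorem expand_tendsto {s : ℕ} (hs : s ≠ 0) {u : ℕ → ℤ⟦X⟧} {g : ℤ⟦X⟧}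
    (h : Tendsto u atTop (nhds g)) :
    Tendsto (fun n ↦ expand s hs (u n)) atTop (nhds (expand s hs g)) := by
  rw [PowerSeries.tendsto_iff_eventually_coeff_eq] at h ⊢
  intro d
  filter_upwards [h (d / s)] with n hn
  simp only [coeff_expand, hn]

theorem expand_eulerF {r s : ℕ} (hr : 0 < r) (hs : s ≠ 0) :
    expand s hs (eulerF r) = eulerF (s * r) := by
  refine tendsto_nhds_unique (expand_tendsto hs (tendsto_eulerF hr))
    ((tendsto_eulerF (r := s * r) (by positivity)).congr fun n ↦ ?_)
  simp only [map_prod, map_sub, map_one, map_pow, expand_X, ← pow_mul, mul_assoc]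

theorem constantCoeff_eulerF {r : ℕ} (hr : 0 < r) : constantCoeff (eulerF r) = 1 := by
  obtain ⟨n, hn⟩ := (PowerSeries.tendsto_iff_eventually_coeff_eq.mp (tendsto_eulerF hr) 0).exists
  rw [← coeff_zero_eq_constantCoeff_apply, ← hn, coeff_zero_eq_constantCoeff_apply, map_prod]
  refine prod_eq_one fun j _ ↦ ?_
  simp [hr.ne']

/-! ### Theta series as counting series, and Gauss's identity -/

/-- The generating function of a weight `w`: the coefficient of `q ^ n` counts the elements of
weight `n`. -/
noncomputable def weightGF {ι : Type*} (w : ι → ℕ) : ℤ⟦X⟧ :=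
  PowerSeries.mk fun n ↦ (Nat.card {i // w i = n} : ℤ)

theorem coeff_weightGF {ι : Type*} (w : ι → ℕ) (n : ℕ) :
    coeff n (weightGF w) = Nat.card {i // w i = n} := coeff_mk _ _

theorem weightGF_mul {ι κ : Type*} (w : ι → ℕ) (v : κ → ℕ) [∀ n, Finite {i // w i = n}]
    [∀ n, Finite {i // v i = n}] :
    weightGF w * weightGF v = weightGF fun p : ι × κ ↦ w p.1 + v p.2 := by
  ext n
  simp only [coeff_mul, coeff_weightGF]
  let e : {p : ι × κ // w p.1 + v p.2 = n} ≃
      (x : antidiagonal n) × ({i // w i = x.1.1} × {j // v j = x.1.2}) :=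
    { toFun := fun p ↦ ⟨⟨(w p.1.1, v p.1.2), mem_antidiagonal.mpr p.2⟩, ⟨p.1.1, rfl⟩, ⟨p.1.2, rfl⟩⟩
      invFun := fun x ↦ ⟨(x.2.1.1, x.2.2.1), by
        rw [x.2.1.2, x.2.2.2]; exact mem_antidiagonal.mp x.1.2⟩
      left_inv := fun p ↦ rfl
      right_inv := by
        rintro ⟨⟨⟨a, b⟩, h⟩, ⟨i, hi⟩, ⟨j, hj⟩⟩
        dsimp only at hi hj
        subst hi hj
        rfl }
  rw [Nat.card_congr e, Nat.card_sigma, ← Finset.sum_coe_sort]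
  push_cast
  simp only [Nat.card_prod, Nat.cast_mul]

theorem expand_weightGF {ι : Type*} (w : ι → ℕ) {r : ℕ} (hr : r ≠ 0) :
    expand r hr (weightGF w) = weightGF fun i ↦ r * w i := by
  ext n
  rw [coeff_expand, coeff_weightGF]
  split_ifs with h
  · obtain ⟨m, rfl⟩ := h
    rw [Nat.mul_div_cancel_left _ hr.bot_lt, coeff_weightGF]
    exact congrArg _ (Nat.card_congr (Equiv.subtypeEquivRight fun i ↦
      (Nat.mul_right_inj hr).symm))
  · have : IsEmpty {i // r * w i = n} := ⟨fun i ↦ h ⟨_, i.2.symm⟩⟩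
    rw [coeff_weightGF, Nat.card_of_isEmpty, Nat.cast_zero]

/-- Ramanujan's theta function `ψ(q) = ∑ q ^ (k (k + 1) / 2)`, over `k ≥ 0`. -/
noncomputable def thetaPsi : ℤ⟦X⟧ := weightGF fun k : ℕ ↦ k * (k + 1) / 2

theorem le_triangle (k : ℕ) : k ≤ k * (k + 1) / 2 := by
  rw [Nat.le_div_iff_mul_le two_pos]
  rcases k with _ | k
  · simp
  · gcongr; omega

theorem tendsto_sum_triangle :
    Tendsto (fun n ↦ ∑ k ∈ range (2 * n), (X : ℤ⟦X⟧) ^ (k * (k + 1) / 2)) atTop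
      (nhds thetaPsi) := by
  refine PowerSeries.tendsto_of_eventually_coeff_eq fun d ↦ ?_
  filter_upwards [eventually_gt_atTop d] with n hn
  rw [thetaPsi, coeff_weightGF, map_sum]
  simp only [coeff_X_pow]
  rw [sum_boole, Nat.cast_inj, ← Nat.subtype_card]
  intro k
  have := le_triangle k
  simp only [mem_filter, mem_range]
  omega

/-- Gauss's identity for the theta series of the triangular numbers. -/
theorem oddEulerF_one_mul_thetaPsi : oddEulerF 1 * thetaPsi = eulerF 2 := by
  refine tendsto_nhds_unique ((tendsto_oddEulerF one_pos).mul tendsto_sum_triangle) ?_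
  rw [PowerSeries.tendsto_iff_eventually_coeff_eq]
  intro d
  have h := PowerSeries.tendsto_iff_eventually_coeff_eq.mp (tendsto_eulerF two_pos) d
  filter_upwards [h, eventually_gt_atTop d] with n hn hd
  rw [← hn]
  simp only [one_mul]
  -- The term s = 0 is the partial product of f_2; every term with s ≥ 1 is divisible by q^(2n+1),
  -- beyond degree d.
  rw [prod_odd_mul_sum_triangle, sum_eq_add_sum_sdiff_singleton_of_mem (mem_range.mpr (by omega : 0 < n)),
    map_add, map_sum, sum_eq_zero, add_zero]
  · simp [mul_add]
  · intro s hs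
    rw [coeff_mul_X_pow', if_neg]
    simp only [Finset.mem_sdiff, mem_range, mem_singleton] at hs
    have : 1 ≤ s := by omega
    nlinarith

/-- The theta series `φ(q) = ∑ q ^ (u ^ 2)`, over all integers `u`. -/
noncomputable def thetaPhi : ℤ⟦X⟧ := weightGF fun u : ℤ ↦ (u ^ 2).toNat

instance finite_triangle (n : ℕ) : Finite {k : ℕ // k * (k + 1) / 2 = n} :=
  Set.Finite.subset (Set.finite_Iic n) fun k hk ↦ by
    exact (le_triangle k).trans (le_of_eq hk)

instance finite_sq (n : ℕ) : Finite {u : ℤ // (u ^ 2).toNat = n} :=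
  Set.Finite.subset (Set.finite_Icc (-n : ℤ) n) fun u hu ↦ by
    have hu : (u ^ 2).toNat = n := hu
    have : u ^ 2 = n := by rw [← hu, Int.toNat_of_nonneg (sq_nonneg u)]
    simp only [Set.mem_Icc]
    constructor <;> nlinarith

instance finite_mul_weight {ι : Type*} (w : ι → ℕ) [h : ∀ n, Finite {i // w i = n}] (r : ℕ)
    [NeZero r] (n : ℕ) : Finite {i // r * w i = n} :=
  Finite.of_injective (β := {i // w i = n / r})
    (fun i ↦ ⟨i.1, (Nat.div_eq_of_eq_mul_right (NeZero.pos r) i.2.symm).symm⟩)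
    fun _ _ hij ↦ Subtype.ext (congrArg (fun x : {i // w i = n / r} ↦ x.1) hij)

/-! ### Theta identities by linear changes of variables -/

theorem two_mul_triangle (k : ℕ) : 2 * ((k * (k + 1) / 2 : ℕ) : ℤ) = k * (k + 1) := by
  have : 2 * (k * (k + 1) / 2) = k * (k + 1) :=
    Nat.mul_div_cancel' (Nat.even_mul_succ_self k).two_dvd
  exact_mod_cast this

/-- The representative in `ℕ` of an integer under the reflection `x ↦ -1 - x`, which fixes
`x (x + 1)`. -/
def triangleIndex (x : ℤ) : ℕ := if 0 ≤ x then x.toNat else (-1 - x).toNat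

theorem triangleIndex_eq (x : ℤ) :
    (0 ≤ x ∧ (triangleIndex x : ℤ) = x) ∨ (x < 0 ∧ (triangleIndex x : ℤ) = -1 - x) := by
  unfold triangleIndex
  split_ifs <;> omega

theorem triangleIndex_mul (x : ℤ) :
    (triangleIndex x : ℤ) * (triangleIndex x + 1) = x * (x + 1) := by
  rcases triangleIndex_eq x with ⟨_, h⟩ | ⟨_, h⟩
  · rw [h]
  · rw [h]
    ring

theorem triangle_add_eq_iff (a b r n : ℕ) :
    a * (a + 1) / 2 + r * (b * (b + 1) / 2) = n ↔
      (a : ℤ) * (a + 1) + r * (b * (b + 1)) = 2 * n := by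
  rw [← two_mul_triangle, ← two_mul_triangle, ← Nat.cast_inj (R := ℤ)]
  push_cast
  constructor <;> intro h <;> linarith

theorem sq_add_triangle_eq_iff (u : ℤ) (k r s n : ℕ) :
    r * (u ^ 2).toNat + s * (k * (k + 1) / 2) = n ↔
      2 * r * u ^ 2 + s * ((k : ℤ) * (k + 1)) = 2 * n := by
  rw [← two_mul_triangle, ← Nat.cast_inj (R := ℤ)]
  push_cast
  rw [Int.toNat_of_nonneg (sq_nonneg u)]
  constructor <;> intro h <;> linarith

theorem triangleIndex_eq_natCast_or (x : ℤ) (k : ℕ) :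
    triangleIndex x = k ↔ x = k ∨ x = -1 - k := by
  rcases triangleIndex_eq x with h | h <;> omega

theorem Nat.card_subtype_eq_of_iff {ι κ : Type*} {p : ι → Prop} {q : κ → Prop} (f : ι → κ)
    (hf : ∀ i, p i ↔ q (f i)) (hinj : ∀ i j, f i = f j → i = j)
    (hsurj : ∀ k, q k → ∃ i, f i = k) : Nat.card {i // p i} = Nat.card {k // q k} := by
  refine Nat.card_congr (Equiv.ofBijective (fun i ↦ ⟨f i.1, (hf _).mp i.2⟩) ⟨?_, ?_⟩)
  · intro i j h
    exact Subtype.ext (hinj _ _ (congrArg Subtype.val h))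
  · rintro ⟨k, hk⟩
    obtain ⟨i, rfl⟩ := hsurj k hk
    exact ⟨⟨i, (hf i).mpr hk⟩, rfl⟩

/-- Substitute a = k+u, b = k-u: the triangular numbers of a and b add up to u² + k(k+1). The
reflection x ↦ -1-x brings negative a or b back to ℕ and also supplies the pairs with a-b odd. -/
theorem thetaPsi_sq : thetaPsi ^ 2 = thetaPhi * expand 2 two_ne_zero thetaPsi := by
  rw [sq, thetaPsi, thetaPhi, expand_weightGF, weightGF_mul, weightGF_mul]
  ext n
  rw [coeff_weightGF, coeff_weightGF, Nat.cast_inj, eq_comm]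
  refine Nat.card_subtype_eq_of_iff
    (fun p : ℤ × ℕ ↦ (triangleIndex (p.2 + p.1), triangleIndex (p.2 - p.1))) ?_ ?_ ?_
  · rintro ⟨u, k⟩
    have h1 := sq_add_triangle_eq_iff u k 1 2 n
    have h2 := triangle_add_eq_iff (triangleIndex (k + u)) (triangleIndex (k - u)) 1 n
    rw [one_mul] at h1 h2
    rw [h1, h2, triangleIndex_mul, triangleIndex_mul]
    push_cast
    constructor <;> intro h <;> linarith
  · rintro ⟨u, k⟩ ⟨v, l⟩ h
    simp only [Prod.mk.injEq] at h ⊢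
    have := triangleIndex_eq (k + u)
    have := triangleIndex_eq (k - u)
    have := triangleIndex_eq (l + v)
    have := triangleIndex_eq (l - v)
    omega
  · rintro ⟨a, b⟩ -
    simp only [Prod.mk.injEq, triangleIndex_eq_natCast_or, Prod.exists]
    rcases Int.even_or_odd' (a - b : ℤ) with ⟨u, hu | hu⟩
    · exact ⟨u, (b + u).toNat, by omega⟩
    · rcases le_or_gt 0 (a - (b + u + 1)) with h | h
      · exact ⟨b + u + 1, (a - (b + u + 1)).toNat, by omega⟩
      · exact ⟨-(b + u + 1), (b + u - a).toNat, by omega⟩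

theorem four_dvd_or_of_mul_eq {x y m r : ℤ} (hxy : Odd (x + y)) (h : x * y = 4 * m + 2 * r) :
    4 ∣ x - 2 * r ∨ 4 ∣ y - 2 * r := by
  rcases Int.even_or_odd' x with ⟨u, rfl | rfl⟩ <;>
    rcases Int.even_or_odd' y with ⟨v, rfl | rfl⟩
  · exact absurd hxy (Int.not_odd_iff_even.mpr ⟨u + v, by ring⟩)
  · left
    have : 2 * u + 4 * (u * v) = 4 * m + 2 * r := by linarith
    omega
  · right
    have : 2 * v + 4 * (u * v) = 4 * m + 2 * r := by linarith
    omega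
  · exact absurd hxy (Int.not_odd_iff_even.mpr ⟨u + v + 1, by ring⟩)

/-- The left side is (a-b)(a+b+1) + 4b(b+1), and the two factors have opposite parity. The two
alternatives are exchanged by b ↦ -1-b, so after a reflection the first may be assumed. -/
theorem four_dvd_or_of_triangle_add {a b n r : ℤ}
    (h : a * (a + 1) + 3 * (b * (b + 1)) = 2 * (2 * n + r)) :
    4 ∣ a - b - 2 * r ∨ 4 ∣ a + b + 1 - 2 * r :=
  four_dvd_or_of_mul_eq ⟨a, by ring⟩
    (show (a - b) * (a + b + 1) = 4 * (n - b * (b + 1)) + 2 * r by linarith)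

theorem coeff_two_mul_thetaPsi_mul_expand (n : ℕ) :
    coeff (2 * n) (thetaPsi * expand 3 three_ne_zero thetaPsi) =
      coeff n (expand 3 three_ne_zero thetaPhi * expand 2 two_ne_zero thetaPsi) := by
  rw [thetaPsi, thetaPhi, expand_weightGF, expand_weightGF, expand_weightGF, weightGF_mul,
    weightGF_mul]
  rw [coeff_weightGF, coeff_weightGF, Nat.cast_inj, eq_comm]
  refine Nat.card_subtype_eq_of_iff
    -- With a = k+3w, b = k-w one has a(a+1) + 3b(b+1) = 12w² + 4k(k+1). Here a-b = 4w, so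
    -- surjectivity needs the divisibility with r = 0.
    (fun p : ℤ × ℕ ↦ (triangleIndex (p.2 + 3 * p.1), triangleIndex (p.2 - p.1))) ?_ ?_ ?_
  · rintro ⟨w, c⟩
    rw [sq_add_triangle_eq_iff, triangle_add_eq_iff, triangleIndex_mul, triangleIndex_mul]
    push_cast
    constructor <;> intro h <;> linarith
  · rintro ⟨u, k⟩ ⟨v, l⟩ h
    simp only [Prod.mk.injEq] at h ⊢
    have := triangleIndex_eq (k + 3 * u)
    have := triangleIndex_eq (k - u)
    have := triangleIndex_eq (l + 3 * v)
    have := triangleIndex_eq (l - v)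
    omega
  · rintro ⟨a, b⟩ h
    rw [triangle_add_eq_iff] at h
    push_cast at h
    simp only [Prod.mk.injEq, triangleIndex_eq_natCast_or, Prod.exists]
    rcases four_dvd_or_of_triangle_add (r := 0) ((add_zero (2 * (n : ℤ))).symm ▸ h) with ⟨w, hw⟩ | ⟨w, hw⟩
    · exact if h : 0 ≤ b + w then ⟨w, (b + w).toNat, by omega⟩
        else ⟨-w, (-1 - b - w).toNat, by omega⟩
    · exact if h : 0 ≤ -1 - b + w then ⟨w, (-1 - b + w).toNat, by omega⟩
        else ⟨-w, (b - w).toNat, by omega⟩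

theorem coeff_two_mul_add_one_thetaPsi_mul_expand (n : ℕ) :
    coeff (2 * n + 1) (thetaPsi * expand 3 three_ne_zero thetaPsi) =
      coeff n (thetaPhi * expand 6 (by norm_num) thetaPsi) := by
  rw [thetaPsi, thetaPhi, expand_weightGF, expand_weightGF, weightGF_mul,
    weightGF_mul]
  rw [coeff_weightGF, coeff_weightGF, Nat.cast_inj, eq_comm]
  refine Nat.card_subtype_eq_of_iff
    -- With a = u+3k+1, b = u-k-1 one has a(a+1) + 3b(b+1) = 4u² + 12k(k+1) + 2. Now a-b = 4k+2, the
    -- case r = 1.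
    (fun p : ℤ × ℕ ↦ (triangleIndex (p.1 + 3 * p.2 + 1), triangleIndex (p.1 - p.2 - 1))) ?_ ?_ ?_
  · rintro ⟨u, k⟩
    have h1 := sq_add_triangle_eq_iff u k 1 6 n
    rw [one_mul] at h1
    rw [h1, triangle_add_eq_iff, triangleIndex_mul, triangleIndex_mul]
    push_cast
    constructor <;> intro h <;> linarith
  · rintro ⟨u, k⟩ ⟨v, l⟩ h
    simp only [Prod.mk.injEq] at h ⊢
    have := triangleIndex_eq (u + 3 * k + 1)
    have := triangleIndex_eq (u - k - 1)
    have := triangleIndex_eq (v + 3 * l + 1)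
    have := triangleIndex_eq (v - l - 1)
    omega
  · rintro ⟨a, b⟩ h
    rw [triangle_add_eq_iff] at h
    push_cast at h
    simp only [Prod.mk.injEq, triangleIndex_eq_natCast_or, Prod.exists]
    rcases four_dvd_or_of_triangle_add h with ⟨w, hw⟩ | ⟨w, hw⟩
    · exact if h : 0 ≤ w then ⟨b + w + 1, w.toNat, by omega⟩
        else ⟨-(b + w + 1), (-1 - w).toNat, by omega⟩
    · exact if h : 0 ≤ w then ⟨w - b, w.toNat, by omega⟩
        else ⟨b - w, (-1 - w).toNat, by omega⟩

/-- Modulo `2`, the theta series `φ` is `1`. -/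
theorem map_thetaPhi_zmod_two : map (Int.castRingHom (ZMod 2)) thetaPhi = 1 := by
  ext n
  rw [coeff_map, thetaPhi, coeff_weightGF, coeff_one]
  rcases eq_or_ne n 0 with rfl | hn
  · have : Nat.card {u : ℤ // (u ^ 2).toNat = 0} = 1 := by
      rw [Nat.card_eq_one_iff_unique]
      refine ⟨⟨fun u v ↦ Subtype.ext ?_⟩, ⟨⟨0, rfl⟩⟩⟩
      have h (u : {u : ℤ // (u ^ 2).toNat = 0}) : u.1 = 0 := by
        have := Int.toNat_eq_zero.mp u.2
        nlinarith
      rw [h u, h v]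
    rw [this]
    rfl
  · rw [if_neg hn]
    by_cases hs : ∃ a : ℤ, (a ^ 2).toNat = n
    · obtain ⟨a, ha⟩ := hs
      have ha0 : a ≠ 0 := by rintro rfl; exact hn (by simpa using ha.symm)
      -- The square roots of a nonzero n come in pairs ±a, so the coefficient is even.
      have hset : {u : ℤ | (u ^ 2).toNat = n} = {a, -a} := by
        ext u
        simp only [Set.mem_ofPred_eq, Set.mem_insert_iff, Set.mem_singleton_iff]
        rw [← sq_eq_sq_iff_eq_or_eq_neg, ← ha]
        have := sq_nonneg u
        have := sq_nonneg a
        omega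
      have hcard : Nat.card {u : ℤ // (u ^ 2).toNat = n} = 2 := by
        have := Set.ncard_pair (a := a) (b := -a) (by omega)
        rwa [← hset] at this
      rw [hcard]
      rfl
    · have : IsEmpty {u : ℤ // (u ^ 2).toNat = n} := ⟨fun u ↦ hs ⟨u.1, u.2⟩⟩
      rw [Nat.card_of_isEmpty]
      rfl

/-! ### The generating function of PD_2 -/

/-- The generating function of partitions with odd parts and designated summands. -/
theorem mk_PD_two_eq_genFun : (PowerSeries.mk fun n ↦ (PD 2 n : ℤ)) =
    Nat.Partition.genFun fun i c ↦ if Odd i then (c : ℤ) else 0 := by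
  classical
  ext n
  rw [coeff_mk, Nat.Partition.coeff_genFun]
  let e : {d : DesignatedPartition n // d.IsRegular 2} ≃
      (p : {p : n.Partition // ∀ i ∈ p.parts, ¬ 2 ∣ i}) ×
        ((i : p.1.parts.toFinset) → Fin (p.1.parts.count i.1)) :=
    { toFun := fun d ↦ ⟨⟨d.1.partition, d.2⟩, d.1.designated⟩
      invFun := fun x ↦ ⟨⟨x.1.1, x.2⟩, x.1.2⟩
      left_inv := fun _ ↦ rfl
      right_inv := fun _ ↦ rfl }
  have hcard (p : n.Partition) : (if ∀ i ∈ p.parts, ¬ 2 ∣ i then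
      (Nat.card ((i : p.parts.toFinset) → Fin (p.parts.count i.1)) : ℤ) else 0) =
      p.parts.toFinsupp.prod fun i c ↦ if Odd i then (c : ℤ) else 0 := by
    rw [Finsupp.prod, Multiset.toFinsupp_support]
    simp only [Multiset.toFinsupp_apply]
    split_ifs with h
    · rw [Nat.card_pi]
      simp only [Nat.card_eq_fintype_card, Fintype.card_fin]
      rw [Finset.prod_coe_sort p.parts.toFinset fun i ↦ p.parts.count i, Nat.cast_prod]
      refine prod_congr rfl fun i hi ↦ ?_
      rw [if_pos]
      rw [← Nat.not_even_iff_odd, even_iff_two_dvd]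
      exact h i (Multiset.mem_toFinset.mp hi)
    · push Not at h
      obtain ⟨i, hi, h2⟩ := h
      refine (prod_eq_zero (Multiset.mem_toFinset.mpr hi) ?_).symm
      rw [if_neg]
      rwa [Nat.not_odd_iff_even, even_iff_two_dvd]
  rw [PD, Nat.card_congr e, Nat.card_sigma, ← sum_congr rfl fun p _ ↦ hcard p, ← sum_filter,
    Nat.cast_sum]
  exact (Finset.sum_subtype _ (by simp) fun p : n.Partition ↦
    (Nat.card ((i : p.parts.toFinset) → Fin (p.parts.count i.1)) : ℤ)).symm

/-- With x = q^i the sum S satisfies (1-x)² S = x, so 1 + S = (1-x+x²)/(1-x)², and (1-x+x²)(1+x) =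
1+x³. -/
theorem tsum_succ_mul_X_pow_mul {i : ℕ} (hi : 0 < i) :
    (1 + ∑' j : ℕ, ((j + 1 : ℕ) : ℤ) • (X : ℤ⟦X⟧) ^ (i * (j + 1))) *
      ((1 - X ^ i) * (1 - X ^ (2 * i)) * (1 - X ^ (3 * i))) = 1 - X ^ (6 * i) := by
  have h0 : constantCoeff ((X : ℤ⟦X⟧) ^ i) = 0 := by simp [hi.ne']
  have hs : Summable fun j : ℕ ↦ ((j + 1 : ℕ) : ℤ) • (X : ℤ⟦X⟧) ^ (i * (j + 1)) :=
    Nat.Partition.summable_genFun_term' (fun _ c ↦ (c : ℤ)) hi.ne'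
  set S := ∑' j : ℕ, ((j + 1 : ℕ) : ℤ) • (X : ℤ⟦X⟧) ^ (i * (j + 1)) with hS
  have hg : Summable fun j : ℕ ↦ ((X : ℤ⟦X⟧) ^ i) ^ j :=
    PowerSeries.WithPiTopology.summable_pow_of_constantCoeff_eq_zero h0
  set G := ∑' j : ℕ, ((X : ℤ⟦X⟧) ^ i) ^ j with hG
  have hG1 : (1 - X ^ i) * G = 1 :=
    PowerSeries.WithPiTopology.one_sub_mul_tsum_pow_of_constantCoeff_eq_zero h0
  have hS1 : S = X ^ i * S + X ^ i * G := by
    have h1 : S = X ^ i + ∑' j : ℕ, (X ^ i * (((j + 1 : ℕ) : ℤ) • X ^ (i * (j + 1))) +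
        X ^ i * (X ^ i) ^ (j + 1)) := by
      rw [hS, hs.tsum_eq_zero_add]
      congr 1
      · simp
      · refine tsum_congr fun j ↦ ?_
        simp only [zsmul_eq_mul]
        push_cast
        ring
    have h2 : G = 1 + ∑' j : ℕ, ((X : ℤ⟦X⟧) ^ i) ^ (j + 1) := by
      rw [hG, hg.tsum_eq_zero_add, pow_zero]
    have hg' := (summable_nat_add_iff 1).mpr hg
    rw [(hs.mul_left _).tsum_add (hg'.mul_left _), hs.tsum_mul_left, hg'.tsum_mul_left] at h1
    linear_combination h1 - X ^ i * h2
  have hS2 : (1 - X ^ i) ^ 2 * S = X ^ i := by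
    linear_combination (1 - X ^ i) * hS1 + X ^ i * hG1
  linear_combination ((1 + X ^ i) * (1 - X ^ (3 * i))) * hS2

theorem mk_PD_two_mul_oddEulerF :
    (PowerSeries.mk fun n ↦ (PD 2 n : ℤ)) * (oddEulerF 1 * oddEulerF 2 * oddEulerF 3) =
      oddEulerF 6 := by
  rw [mk_PD_two_eq_genFun]
  have h := ((Nat.Partition.hasProd_genFun
    fun i c ↦ if Odd i then (c : ℤ) else 0).tendsto_prod_nat).comp tendsto_two_mul_atTop
  refine tendsto_nhds_unique (h.mul (((tendsto_oddEulerF one_pos).mul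
    (tendsto_oddEulerF two_pos)).mul (tendsto_oddEulerF three_pos)))
    ((tendsto_oddEulerF (r := 6) (by norm_num)).congr fun n ↦ ?_)
  simp only [Function.comp, prod_range_two_mul]
  rw [mul_assoc, ← prod_mul_distrib, ← prod_mul_distrib, mul_left_comm, ← prod_mul_distrib,
    eq_comm]
  -- Index j stands for part size j+1: odd indices are even sizes and contribute 1.
  refine (congrArg₂ (· * ·) (prod_eq_one fun k _ ↦ ?_) (prod_congr rfl fun k _ ↦ ?_)).trans
    (one_mul _)
  · have hk : ¬ Odd (2 * k + 1 + 1) := Nat.not_odd_iff_even.mpr ⟨k + 1, by ring⟩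
    simp only [if_neg hk, smul_eq_C_mul, map_zero, zero_mul, tsum_zero, add_zero]
  · have hk : Odd (2 * k + 1) := odd_two_mul_add_one k
    simp only [if_pos hk, one_mul]
    exact tsum_succ_mul_X_pow_mul (Nat.succ_pos _)

/-! ### Even and odd parts of power series -/

section Dissection

variable {R : Type*} [CommRing R]

/-- A power series is assembled from its even and odd parts. -/
theorem PowerSeries.eq_expand_two_add_X_mul_expand_two {p a b : R⟦X⟧}
    (ha : ∀ n, coeff (2 * n) p = coeff n a) (hb : ∀ n, coeff (2 * n + 1) p = coeff n b) :
    p = expand 2 two_ne_zero a + X * expand 2 two_ne_zero b := by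
  ext n
  rcases Nat.even_or_odd' n with ⟨m, rfl | rfl⟩
  · rw [map_add, coeff_expand_mul, ha]
    rcases m with _ | m
    · simp
    · rw [show 2 * (m + 1) = 2 * m + 1 + 1 by ring, coeff_succ_X_mul,
        coeff_expand_of_not_dvd _ _ _ (by omega), add_zero]
  · rw [map_add, coeff_succ_X_mul, coeff_expand_mul, hb,
      coeff_expand_of_not_dvd _ _ _ (by omega), zero_add]

theorem PowerSeries.coeff_two_mul_expand_two_add (a b : R⟦X⟧) (n : ℕ) :
    coeff (2 * n) (expand 2 two_ne_zero a + X * expand 2 two_ne_zero b) = coeff n a := by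
  rw [map_add, coeff_expand_mul]
  rcases n with _ | m
  · simp
  · rw [show 2 * (m + 1) = 2 * m + 1 + 1 by ring, coeff_succ_X_mul,
      coeff_expand_of_not_dvd _ _ _ (by omega), add_zero]

theorem PowerSeries.coeff_two_mul_add_one_expand_two_add (a b : R⟦X⟧) (n : ℕ) :
    coeff (2 * n + 1) (expand 2 two_ne_zero a + X * expand 2 two_ne_zero b) = coeff n b := by
  rw [map_add, coeff_succ_X_mul, coeff_expand_mul,
    coeff_expand_of_not_dvd _ _ _ (by omega), zero_add]

theorem PowerSeries.expand_two_add_X_mul_expand_two_inj {a b c d : R⟦X⟧}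
    (h : expand 2 two_ne_zero a + X * expand 2 two_ne_zero b =
      expand 2 two_ne_zero c + X * expand 2 two_ne_zero d) : a = c ∧ b = d := by
  constructor <;> ext n
  · rw [← coeff_two_mul_expand_two_add a b, h, coeff_two_mul_expand_two_add]
  · rw [← coeff_two_mul_add_one_expand_two_add a b, h, coeff_two_mul_add_one_expand_two_add]

theorem PowerSeries.expand_two_eq_sq (p : (ZMod 2)⟦X⟧) : expand 2 two_ne_zero p = p ^ 2 := by
  have h := MvPowerSeries.map_frobenius_expand (σ := Unit) (R := ZMod 2) 2 two_ne_zero (f := p)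
  rw [ZMod.frobenius_zmod, MvPowerSeries.map_id] at h
  exact h

end Dissection

/-! ### Exact dissections over ℤ -/

/-- `thetaPsi` in the variable `q ^ r`, in terms of Euler products. -/
theorem eulerF_mul_expand_thetaPsi {r : ℕ} (hr : r ≠ 0) :
    eulerF r * expand r hr thetaPsi = eulerF (2 * r) ^ 2 := by
  have h : eulerF 1 * thetaPsi = eulerF 2 ^ 2 := by
    linear_combination (-thetaPsi) * oddEulerF_mul_eulerF one_pos +
      eulerF 2 * oddEulerF_one_mul_thetaPsi
  have h := congrArg (expand r hr) h
  rwa [map_mul, map_pow, expand_eulerF one_pos, expand_eulerF two_pos, mul_one, mul_comm r 2] at h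

theorem eulerF_ne_zero {r : ℕ} (hr : 0 < r) : eulerF r ≠ 0 := fun h ↦ by
  have := constantCoeff_eulerF hr
  rw [h, map_zero] at this
  exact zero_ne_one this

/-- The theta series `ψ(q ^ r)`. -/
noncomputable abbrev psi (r : ℕ) [NeZero r] : ℤ⟦X⟧ := expand r (NeZero.ne r) thetaPsi

/-- The theta series `φ(q ^ r)`. -/
noncomputable abbrev phi (r : ℕ) [NeZero r] : ℤ⟦X⟧ := expand r (NeZero.ne r) thetaPhi

theorem eulerF_mul_psi (r : ℕ) [NeZero r] : eulerF r * psi r = eulerF (2 * r) ^ 2 :=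
  eulerF_mul_expand_thetaPsi _

theorem psi_mul_psi_three : psi 1 * psi 3 =
    expand 2 two_ne_zero (phi 3 * psi 2) + X * expand 2 two_ne_zero (phi 1 * psi 6) := by
  apply eq_expand_two_add_X_mul_expand_two
  · intro n
    simp only [psi, phi, expand_one_apply]
    exact coeff_two_mul_thetaPsi_mul_expand n
  · intro n
    simp only [psi, phi, expand_one_apply]
    exact coeff_two_mul_add_one_thetaPsi_mul_expand n

theorem psi_three_sq : psi 3 ^ 2 = phi 3 * psi 6 := by
  have h := congrArg (expand 3 three_ne_zero) thetaPsi_sq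
  rwa [map_pow, map_mul, ← expand_mul] at h

theorem expand_two_eulerF {r : ℕ} (hr : 0 < r) :
    expand 2 two_ne_zero (eulerF r) = eulerF (2 * r) :=
  expand_eulerF hr two_ne_zero

theorem mk_PD_two_mul_eulerF :
    (PowerSeries.mk fun n ↦ (PD 2 n : ℤ)) * (eulerF 2 ^ 2 * eulerF 12) =
      eulerF 4 * (psi 1 * psi 3) := by
  have h1 := oddEulerF_mul_eulerF one_pos
  have h2 := oddEulerF_mul_eulerF two_pos
  have h3 := oddEulerF_mul_eulerF three_pos
  have h6 := oddEulerF_mul_eulerF (r := 6) (by norm_num)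
  have g1 := eulerF_mul_psi 1
  have g3 := eulerF_mul_psi 3
  have h := mk_PD_two_mul_oddEulerF
  norm_num only at h1 h2 h3 h6 g1 g3
  set F := PowerSeries.mk fun n ↦ (PD 2 n : ℤ)
  have h0 : F * (eulerF 1 * eulerF 3 * eulerF 12) = eulerF 4 * eulerF 6 ^ 2 := by
    linear_combination (eulerF 4 * eulerF 6 * eulerF 12) * h + eulerF 4 * eulerF 6 * h6 -
      F * eulerF 12 * (oddEulerF 3 * eulerF 6 * (oddEulerF 1 * h2 + h1) + eulerF 1 * h3)
  refine mul_right_cancel₀ (pow_ne_zero 2 (eulerF_ne_zero (r := 6) (by norm_num))) ?_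
  linear_combination psi 1 * psi 3 * h0 - F * eulerF 12 * psi 3 * eulerF 3 * g1 -
    F * eulerF 12 * eulerF 2 ^ 2 * g3

theorem mk_eq_expand_two_add (u : ℕ → ℤ) : PowerSeries.mk u =
    expand 2 two_ne_zero (PowerSeries.mk fun n ↦ u (2 * n)) +
      X * expand 2 two_ne_zero (PowerSeries.mk fun n ↦ u (2 * n + 1)) :=
  eq_expand_two_add_X_mul_expand_two (fun n ↦ by simp only [coeff_mk])
    fun n ↦ by simp only [coeff_mk]

theorem mk_PD_two_two_mul_eulerF :
    (PowerSeries.mk fun n ↦ (PD 2 (2 * n) : ℤ)) * (eulerF 1 ^ 2 * eulerF 6) =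
      eulerF 2 * (phi 3 * psi 2) := by
  have h := mk_PD_two_mul_eulerF
  rw [psi_mul_psi_three, mk_eq_expand_two_add] at h
  have e1 := expand_two_eulerF one_pos
  have e2 := expand_two_eulerF two_pos
  have e6 := expand_two_eulerF (r := 6) (by norm_num)
  norm_num only at e1 e2 e6
  rw [← e1, ← e2, ← e6, ← map_pow, ← map_mul, add_mul, mul_add, mul_assoc, mul_left_comm _ X,
    ← map_mul, ← map_mul, ← map_mul, ← map_mul] at h
  exact (expand_two_add_X_mul_expand_two_inj h).1

/-- Purpose: apart from the square of ψ(q)ψ(q³), only series in q² remain, so the next dissection is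
that of a square. The rewriting uses φ(q³) = ψ(q³)²/ψ(q⁶) and 1/f_1² = ψ(q)²/f_2⁴. -/
theorem mk_PD_two_two_mul_eulerF_eq_sq :
    (PowerSeries.mk fun n ↦ (PD 2 (2 * n) : ℤ)) * (eulerF 2 ^ 4 * eulerF 12 ^ 2) =
      eulerF 4 ^ 2 * (psi 1 * psi 3) ^ 2 := by
  have h := mk_PD_two_two_mul_eulerF
  have g1 := eulerF_mul_psi 1
  have g2 := eulerF_mul_psi 2
  have g6 := eulerF_mul_psi 6
  have s := psi_three_sq
  norm_num only at g1 g2 g6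
  set E := PowerSeries.mk fun n ↦ (PD 2 (2 * n) : ℤ)
  refine mul_left_cancel₀ (eulerF_ne_zero two_pos) ?_
  linear_combination (eulerF 2 * psi 1 ^ 2 * psi 6) * h -
    eulerF 2 * E * ((eulerF 1 * psi 1) ^ 2 * g6 +
      eulerF 12 ^ 2 * (eulerF 1 * psi 1 + eulerF 2 ^ 2) * g1) +
    eulerF 2 * psi 1 ^ 2 * (phi 3 * psi 6 * g2 - eulerF 4 ^ 2 * s)

theorem mk_PD_two_four_mul_add_two_mul_eulerF :
    (PowerSeries.mk fun n ↦ (PD 2 (4 * n + 2) : ℤ)) * (eulerF 1 ^ 4 * eulerF 6 ^ 2) =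
      eulerF 2 ^ 2 * (2 * (phi 3 * psi 2 * (phi 1 * psi 6))) := by
  have h := mk_PD_two_two_mul_eulerF_eq_sq
  have hsq (a b : ℤ⟦X⟧) : (expand 2 two_ne_zero a + X * expand 2 two_ne_zero b) ^ 2 =
      expand 2 two_ne_zero (a ^ 2 + X * b ^ 2) + X * expand 2 two_ne_zero (2 * (a * b)) := by
    simp only [map_add, map_mul, map_pow, expand_X, map_ofNat]
    ring
  rw [psi_mul_psi_three, mk_eq_expand_two_add, hsq] at h
  have e1 := expand_two_eulerF one_pos
  have e2 := expand_two_eulerF two_pos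
  have e6 := expand_two_eulerF (r := 6) (by norm_num)
  norm_num only at e1 e2 e6
  rw [← e1, ← e2, ← e6, ← map_pow, ← map_pow, ← map_pow, ← map_mul, add_mul, mul_add, mul_assoc,
    mul_left_comm _ X, ← map_mul, ← map_mul, ← map_mul, ← map_mul] at h
  have h := (expand_two_add_X_mul_expand_two_inj h).2
  have hmk : (fun n ↦ (PD 2 (2 * (2 * n + 1)) : ℤ)) = fun n ↦ (PD 2 (4 * n + 2) : ℤ) := by
    funext n
    ring_nf
  rwa [hmk] at h

/-- The Euler products have constant term 1, hence are invertible over ℤ; this extracts the factor 2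
and reduces a congruence modulo 4 to one modulo 2. -/
theorem exists_mk_PD_eq_two_mul : ∃ D : ℤ⟦X⟧,
    (PowerSeries.mk fun n ↦ (PD 2 (4 * n + 2) : ℤ)) = 2 * D ∧
      D * (eulerF 1 ^ 4 * eulerF 6 ^ 2) = eulerF 2 ^ 2 * (phi 3 * psi 2 * (phi 1 * psi 6)) := by
  have hu : IsUnit (eulerF 1 ^ 4 * eulerF 6 ^ 2) := by
    rw [isUnit_iff_constantCoeff, map_mul, map_pow, map_pow, constantCoeff_eulerF one_pos,
      constantCoeff_eulerF (by norm_num)]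
    simp
  obtain ⟨v, hv⟩ := hu.exists_right_inv
  have h := mk_PD_two_four_mul_add_two_mul_eulerF
  set Y := eulerF 2 ^ 2 * (phi 3 * psi 2 * (phi 1 * psi 6)) with hY
  refine ⟨Y * v, ?_, by linear_combination Y * hv⟩
  linear_combination v * h - (PowerSeries.mk fun n ↦ (PD 2 (4 * n + 2) : ℤ)) * hv + 2 * v * hY

/-! ### Reduction modulo 2 -/

/-- Reduction of the coefficients of a power series modulo `2`. -/
noncomputable abbrev mapZModTwo : ℤ⟦X⟧ →+* (ZMod 2)⟦X⟧ := map (Int.castRingHom (ZMod 2))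

theorem mapZModTwo_eulerF_two_mul {r : ℕ} (hr : 0 < r) :
    mapZModTwo (eulerF (2 * r)) = mapZModTwo (eulerF r) ^ 2 := by
  rw [← expand_two_eulerF hr, map_expand, expand_two_eq_sq]

theorem mapZModTwo_eulerF_ne_zero {r : ℕ} (hr : 0 < r) : mapZModTwo (eulerF r) ≠ 0 := fun h ↦ by
  have h := congrArg (coeff 0) h
  rw [coeff_map, coeff_zero_eq_constantCoeff_apply, constantCoeff_eulerF hr] at h
  simp at h

theorem mapZModTwo_psi (r : ℕ) [NeZero r] : mapZModTwo (psi r) = mapZModTwo (eulerF r) ^ 3 := by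
  have hr := NeZero.pos r
  refine mul_left_cancel₀ (mapZModTwo_eulerF_ne_zero hr) ?_
  rw [← map_mul, eulerF_mul_psi, map_pow, mapZModTwo_eulerF_two_mul hr]
  ring

theorem mapZModTwo_phi (r : ℕ) [NeZero r] : mapZModTwo (phi r) = 1 := by
  rw [map_expand, map_thetaPhi_zmod_two, map_one]

theorem mapZModTwo_of_mul_eulerF_eq {D : ℤ⟦X⟧}
    (hD : D * (eulerF 1 ^ 4 * eulerF 6 ^ 2) =
      eulerF 2 ^ 2 * (phi 3 * psi 2 * (phi 1 * psi 6))) :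
    mapZModTwo D =
      expand 2 two_ne_zero (mapZModTwo (eulerF 1) ^ 3 * mapZModTwo (eulerF 3)) := by
  have h := congrArg mapZModTwo hD
  have e1 := mapZModTwo_eulerF_two_mul one_pos
  have e3 := mapZModTwo_eulerF_two_mul three_pos
  norm_num only at e1 e3
  simp only [map_mul, map_pow, mapZModTwo_psi, mapZModTwo_phi, e1, e3] at h
  rw [expand_two_eq_sq]
  refine mul_right_cancel₀ (mul_ne_zero (pow_ne_zero 4 (mapZModTwo_eulerF_ne_zero one_pos))
    (pow_ne_zero 4 (mapZModTwo_eulerF_ne_zero three_pos))) ?_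
  linear_combination h

/-- Modulo 2, P f_3² = f_1³ f_3³ ≡ ψ(q)ψ(q³), and f_3² ≡ f_3(q²) is even, so it passes through the
dissection. Comparing odd parts, the odd part of P times f_3 is ψ(q⁶) ≡ f_6³ ≡ f_3⁶; cancelling f_3
leaves f_3⁵ ≡ f_3 f_6². -/
theorem coeff_two_mul_add_one_eulerF_pow_three_mul (n : ℕ) :
    coeff (2 * n + 1) (mapZModTwo (eulerF 1) ^ 3 * mapZModTwo (eulerF 3)) =
      coeff n (mapZModTwo (eulerF 3 * eulerF 6 ^ 2)) := by
  set P := mapZModTwo (eulerF 1) ^ 3 * mapZModTwo (eulerF 3) with hP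
  have h := congrArg mapZModTwo psi_mul_psi_three
  have e3 := mapZModTwo_eulerF_two_mul three_pos
  norm_num only at e3
  rw [map_mul, map_add, map_mul _ X, mapZModTwo_psi, mapZModTwo_psi, map_X, map_expand, map_expand,
    map_mul _ (phi 1), mapZModTwo_phi, mapZModTwo_psi, e3, one_mul,
    show mapZModTwo (eulerF 1) ^ 3 * mapZModTwo (eulerF 3) ^ 3 =
      P * mapZModTwo (eulerF 3) ^ 2 by rw [hP]; ring, ← expand_two_eq_sq,
    eq_expand_two_add_X_mul_expand_two (p := P) (a := PowerSeries.mk fun n ↦ coeff (2 * n) P)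
      (b := PowerSeries.mk fun n ↦ coeff (2 * n + 1) P) (fun n ↦ by rw [coeff_mk])
      (fun n ↦ by rw [coeff_mk]), add_mul, mul_assoc, ← map_mul, ← map_mul] at h
  have h := (expand_two_add_X_mul_expand_two_inj h).2
  have hQ : (PowerSeries.mk fun n ↦ coeff (2 * n + 1) P) =
      mapZModTwo (eulerF 3 * eulerF 6 ^ 2) := by
    refine mul_right_cancel₀ (mapZModTwo_eulerF_ne_zero three_pos) ?_
    rw [h, map_mul, map_pow, e3, expand_two_eq_sq]
    ring
  rw [← hQ, coeff_mk]

/-! ### The congruences modulo 4 -/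

theorem PD_two_modEq (n : ℕ) :
    (PD 2 (16 * n + 10) : ℤ) ≡ coeff n (2 * eulerF 3 * eulerF 6 ^ 2) [ZMOD 4] := by
  obtain ⟨D, hD2, hD⟩ := exists_mk_PD_eq_two_mul
  have h1 : (PD 2 (16 * n + 10) : ℤ) = 2 * coeff (2 * (2 * n + 1)) D := by
    have h := congrArg (coeff (2 * (2 * n + 1))) hD2
    -- The even index is needed since D ≡ P(q²), the odd index 2n+1 inside it to reach the odd part
    -- of P.
    rw [coeff_mk, show 4 * (2 * (2 * n + 1)) + 2 = 16 * n + 10 by ring, two_mul D,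
      map_add] at h
    rw [h, two_mul (coeff _ D)]
  have h2 : ((coeff (2 * (2 * n + 1)) D : ℤ) : ZMod 2) =
      ((coeff n (eulerF 3 * eulerF 6 ^ 2) : ℤ) : ZMod 2) := by
    have h := congrArg (coeff (2 * (2 * n + 1))) (mapZModTwo_of_mul_eulerF_eq hD)
    rwa [coeff_expand_mul, coeff_two_mul_add_one_eulerF_pow_three_mul, coeff_map, coeff_map] at h
  have h3 := (ZMod.intCast_eq_intCast_iff _ _ 2).mp h2
  rw [h1, mul_assoc, two_mul (eulerF 3 * _), map_add, ← two_mul]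
  exact h3.mul_left' (c := 2)

theorem coeff_eulerF_three_mul_eulerF_six_sq {n : ℕ} (hn : ¬ 3 ∣ n) :
    coeff n (2 * eulerF 3 * eulerF 6 ^ 2) = 0 := by
  have h1 := expand_eulerF one_pos three_ne_zero
  have h2 := expand_eulerF two_pos three_ne_zero
  norm_num only at h1 h2
  rw [show 2 * eulerF 3 * eulerF 6 ^ 2 = expand 3 three_ne_zero (2 * eulerF 1 * eulerF 2 ^ 2) by
    simp only [map_mul, map_pow, map_ofNat, h1, h2]]
  exact coeff_expand_of_not_dvd _ _ _ hn

theorem mainTheorem6 :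
    (∀ n : ℕ, PD 2 (48 * n + 26) ≡ 0 [MOD 4]) ∧
    (∀ n : ℕ, coeff n (PowerSeries.mk fun m : ℕ ↦ (PD 2 (16 * m + 10) : ℤ)) ≡
      coeff n (2 * eulerF 3 * eulerF 6 ^ 2) [ZMOD 4]) ∧
    (∀ n : ℕ, ¬ 3 ∣ n → coeff n (2 * eulerF 3 * eulerF 6 ^ 2) = 0) := by
  refine ⟨fun n ↦ ?_, fun n ↦ ?_, fun n ↦ coeff_eulerF_three_mul_eulerF_six_sq⟩
  · have h := PD_two_modEq (3 * n + 1)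
    rw [coeff_eulerF_three_mul_eulerF_six_sq (by omega),
      show 16 * (3 * n + 1) + 10 = 48 * n + 26 by ring] at h
    exact_mod_cast h
  · rw [coeff_mk]
    exact PD_two_modEq n
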